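/- Let $W\subset\mathbb C^n$ be an affine algebraic variety (the common zero set of a set of complex polynomials), with irreducible decomposition $W=W_1\cup\dots\cup W_r$; that is, each $W_i$ is a nonempty variety that is not the union of two proper subvarieties, and $W_i\not\subseteq W_j$ for $i\ne j$. Let $\overline W$ be the complex conjugate of $W$, let $V=W\cup\overline W$, and let $\mathbb R[V]=\mathbb R[x_1,\dots,x_n]/\{f : f(z)=0 \text{ for all } z\in V\}$. Let $\mathcal L\subset\mathbb R[V]$ be a real linear subspace of finite dimension $D$, and let $S_1,\dots,S_r$ be nonnegative integers with $S_i\ge D/2$ for all $i$. Then the pair $(\mathcal L, Z_1\cup\dots\cup Z_r)$ is poised for conjugate-generic tuples of samples $Z_1,\dots,Z_r$, where $Z_i=(z_{i,1},\dots,z_{i,S_i})$ is a tuple of $S_i$ points of $W_i$. Explicitly, there are complex polynomials $q_1,\dots,q_r$, with $q_i=q_i(Z_i,\overline{Z_i})$ a polynomial in the coordinates of the $S_i$ points of $Z_i$ and in the complex conjugates of these coordinates, such that 1. for every $i$, $q_i(Z_i,\overline{Z_i})$ is not identically zero on $Z_i\in W_i^{S_i}$; and 2. for all $Z_1\in W_1^{S_1},\dots,Z_r\in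 W_r^{S_r}$ with $q_i(Z_i,\overline{Z_i})\neq0$ for every $i$, the only $f\in\mathcal L$ with $f(z)=0$ for all $z\in Z_1\cup\dots\cup Z_r$ is $f=0$ in $\mathbb R[V]$. -/

import Mathlib

open scoped ComplexConjugate

noncomputable section

namespace SampledVariety

open MvPolynomial

/-- `V ⊆ ℂⁿ` is a (complex, affine, possibly reducible) algebraic variety: the common zero set
of an ideal of complex polynomials. -/
def IsVariety {n : ℕ} (V : Set (Fin n → ℂ)) : Prop :=
  ∃ I : Ideal (MvPolynomial (Fin n) ℂ), V = zeroLocus ℂ I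

/-- A variety is irreducible if it is nonempty and is not the union of two proper
subvarieties. -/
structure IsIrreducibleVariety {n : ℕ} (V : Set (Fin n → ℂ)) : Prop where
  isVariety : IsVariety V
  nonempty : V.Nonempty
  eq_or_eq_of_eq_union : ∀ A B : Set (Fin n → ℂ), IsVariety A → IsVariety B →
    V = A ∪ B → V = A ∨ V = B

/-- `V = V₁ ∪ ⋯ ∪ Vᵣ` is the irreducible decomposition of `V`. -/
structure IsIrreducibleDecomposition {n r : ℕ} (V : Set (Fin n → ℂ))
    (Vi : Fin r → Set (Fin n → ℂ)) : Prop where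
  irreducible : ∀ i, IsIrreducibleVariety (Vi i)
  eq_iUnion : V = ⋃ i, Vi i
  not_subset : ∀ i j, i ≠ j → ¬ Vi i ⊆ Vi j

/-- The complex conjugate of a subset of `ℂⁿ`. -/
def conjSet {n : ℕ} (W : Set (Fin n → ℂ)) : Set (Fin n → ℂ) :=
  (fun z k => conj (z k)) '' W

/-- The real coordinate ring `ℝ[V] = ℝ[x₁, …, xₙ] / I_ℝ(V)`, where `I_ℝ(V)` is the ideal of the
real polynomials that vanish on the set `V` of complex points. -/
abbrev RealCoordinateRing {n : ℕ} (V : Set (Fin n → ℂ)) : Type :=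
  MvPolynomial (Fin n) ℝ ⧸ vanishingIdeal ℝ V

/-- Evaluation of an element of `ℝ[V]` at a point `z ∈ V`. -/
def evalAt {n : ℕ} {V : Set (Fin n → ℂ)} (z : V) : RealCoordinateRing V →ₐ[ℝ] ℂ :=
  Ideal.Quotient.liftₐ (vanishingIdeal ℝ V) (aeval (z : Fin n → ℂ)) (fun _ hp => hp z z.2)

/-- `(L, Z)` is poised: the only `q ∈ L` that vanishes at every sample `z ∈ Z` is zero. -/
def IsPoised {n : ℕ} {V : Set (Fin n → ℂ)} (L : Submodule ℝ (RealCoordinateRing V))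
    (Z : Set V) : Prop :=
  ∀ q ∈ L, (∀ z ∈ Z, evalAt z q = 0) → q = 0

/-- The ring `ℂ[z₁, …, z_S, z̄₁, …, z̄_S]` of polynomials in the coordinates of `S` points of
`ℂⁿ` (left summand) and in their complex conjugates (right summand). -/
abbrev ConjPolynomial (n S : ℕ) : Type :=
  MvPolynomial ((Fin S × Fin n) ⊕ (Fin S × Fin n)) ℂ

/-- The value `q(z₁, …, z_S, conj z₁, …, conj z_S)`. -/
def conjEval {n S : ℕ} (z : Fin S → Fin n → ℂ) (q : ConjPolynomial n S) : ℂ :=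
  eval (Sum.elim (fun p => z p.1 p.2) (fun p => conj (z p.1 p.2))) q

/-- Tuples of samples `(Z₁, …, Zᵣ)`, with `Zᵢ` consisting of `S i` points of `Wᵢ`, satisfy the
property `P` c-generically (conjugate generically): there are polynomials `qᵢ(Zᵢ, conj Zᵢ)`, not
identically zero for `Zᵢ` in `Wᵢ`, such that `P` holds whenever all `qᵢ(Zᵢ, conj Zᵢ)` are
nonzero. -/
def CGenerically {n r : ℕ} (W : Fin r → Set (Fin n → ℂ)) (S : Fin r → ℕ)
    (P : (∀ i, Fin (S i) → W i) → Prop) : Prop :=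
  ∃ q : ∀ i, ConjPolynomial n (S i),
    (∀ i, ∃ Zi : Fin (S i) → W i, conjEval (fun s => (Zi s : Fin n → ℂ)) (q i) ≠ 0) ∧
    ∀ Z : ∀ i, Fin (S i) → W i,
      (∀ i, conjEval (fun s => (Z i s : Fin n → ℂ)) (q i) ≠ 0) → P Z

end SampledVariety

end

open SampledVariety

/-!
Since `V` is the union of `W` and its conjugate, a real polynomial that vanishes on every component
`Wᵢ` vanishes on `V`. So it suffices to treat one component `X = Wᵢ` and the real space `M` of
functions on `X` obtained by restricting `L`, of dimension at most `D`.

A sample `z ∈ X` imposes on `f ∈ M` the condition `f z = 0`, hence at most two real conditions. If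
for some `z` it imposes exactly two, pass to the subspace of the `f` with `f z = 0`, whose dimension
is smaller by `2`, and continue (`exists_sample_of_finrank_le`). If for all `z` it imposes at most
one, then `f z * conj (g z)` is real for all `f, g ∈ M` and all `z ∈ X`, and then all elements of
`M` are real multiples of one of them, so that one more sample is enough.

The last claim is where irreducibility enters (`exists_eq_real_mul_of_im_eq_zero`). Let `h = f / g`
in the function field of `X`. If `h` is algebraic over `ℂ`, it is a constant, which must be real.
If `h` is transcendental, take any nonreal `c`. Then `f - c g` has zeros on `X` only where `g`
vanishes, so by the Nullstellensatz it divides a power of `g` modulo the ideal of `X`, and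
`(h - c)⁻¹` lies in the algebra generated by the coordinates and `g⁻¹`. This algebra has countable
dimension over `ℂ`, whereas the elements `(h - c)⁻¹` are linearly independent and uncountable in
number, a contradiction.

Finally, `ConjPolynomial.gram` expresses the real part of the Gram matrix of a basis of `M`,
evaluated at the samples, up to a factor `2`, as a matrix of polynomials in the coordinates and
their conjugates. It is nonsingular exactly when no nonzero element of `M` vanishes at all the
samples, so its determinant serves as the polynomial `qᵢ`.
-/

namespace SampledVariety

open MvPolynomial Module

/-! ### Rational functions with real values on an irreducible variety -/

/-- A subalgebra of countable dimension over `k` contains `(x - c)⁻¹` for at most countably many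
`c`, if `x` is transcendental. -/
theorem exists_inv_sub_notMem_range {k K σ : Type} [Field k] [Field K] [Algebra k K] [Countable σ]
    (φ : MvPolynomial σ k →ₐ[k] K) {x : K} (hx : Transcendental k x) {T : Set k}
    (hT : ¬ T.Countable) : ∃ c ∈ T, (x - algebraMap k K c)⁻¹ ∉ φ.range := by
  by_contra! hcon
  have hli := hx.linearIndependent_sub_inv.comp ((↑) : T → k) Subtype.val_injective
  let v : T → LinearMap.range φ.toLinearMap := fun c =>
    ⟨(x - algebraMap k K c)⁻¹, hcon c c.2⟩
  have hv : LinearIndependent k v :=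
    LinearIndependent.of_comp (LinearMap.range φ.toLinearMap).subtype hli
  refine hT ?_
  rw [← Cardinal.le_aleph0_iff_set_countable]
  calc Cardinal.mk T ≤ Module.rank k (LinearMap.range φ.toLinearMap) := hv.cardinal_le_rank
    _ ≤ Module.rank k (MvPolynomial σ k) := rank_range_le _
    _ = Cardinal.mk (σ →₀ ℕ) := by rw [MvPolynomial.rank_eq_lift]; simp
    _ ≤ Cardinal.aleph0 := Cardinal.mk_le_aleph0

theorem not_countable_im_ne_zero : ¬ {c : ℂ | c.im ≠ 0}.Countable := by
  intro h
  have hinj : Function.Injective fun a : ℝ => (⟨a, 1⟩ : ℂ) := fun a b hab =>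
    congrArg Complex.re hab
  have := h.preimage_of_injOn (f := fun a : ℝ => (⟨a, 1⟩ : ℂ)) hinj.injOn
  refine Cardinal.not_countable_real (this.mono fun a _ => ?_)
  simp

variable {n : ℕ}

theorem IsVariety.inter_zeros {X : Set (Fin n → ℂ)} (hX : IsVariety X)
    (p : MvPolynomial (Fin n) ℂ) : IsVariety (X ∩ {z | aeval z p = 0}) := by
  obtain ⟨I, rfl⟩ := hX
  refine ⟨I ⊔ Ideal.span {p}, ?_⟩
  rw [zeroLocus_vanishingIdeal_galoisConnection.l_sup, zeroLocus_span]
  ext z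
  simp only [Set.mem_inter_iff, Set.mem_ofPred_eq, Set.mem_singleton_iff, forall_eq]
  rfl

theorem IsIrreducibleVariety.isPrime_vanishingIdeal {X : Set (Fin n → ℂ)}
    (hX : IsIrreducibleVariety X) : (vanishingIdeal ℂ X).IsPrime := by
  refine ⟨fun h => ?_, fun {p q} hpq => ?_⟩
  · obtain ⟨z, hz⟩ := hX.nonempty
    have h1 : (1 : MvPolynomial (Fin n) ℂ) ∈ vanishingIdeal ℂ X := by rw [h]; trivial
    simpa using h1 z hz
  · have hunion : X = X ∩ {z | aeval z p = 0} ∪ X ∩ {z | aeval z q = 0} := by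
      ext z
      constructor
      · intro hz
        have := hpq z hz
        rw [map_mul, mul_eq_zero] at this
        exact this.imp (fun h => ⟨hz, h⟩) (fun h => ⟨hz, h⟩)
      · rintro (h | h) <;> exact h.1
    rcases hX.eq_or_eq_of_eq_union _ _ (hX.isVariety.inter_zeros p)
      (hX.isVariety.inter_zeros q) hunion with h | h
    · exact Or.inl fun z hz => (h ▸ hz : z ∈ X ∩ {z | aeval z p = 0}).2
    · exact Or.inr fun z hz => (h ▸ hz : z ∈ X ∩ {z | aeval z q = 0}).2

/-- The Nullstellensatz relative to a variety `X`. -/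
theorem IsVariety.exists_pow_sub_mul_mem {X : Set (Fin n → ℂ)} (hX : IsVariety X)
    {p g : MvPolynomial (Fin n) ℂ} (h : ∀ z ∈ X, aeval z p = 0 → aeval z g = 0) :
    ∃ (N : ℕ) (u : MvPolynomial (Fin n) ℂ), g ^ N - u * p ∈ vanishingIdeal ℂ X := by
  obtain ⟨I, rfl⟩ := hX
  have hg : g ∈ (I ⊔ Ideal.span {p}).radical := by
    rw [← vanishingIdeal_zeroLocus_eq_radical (K := ℂ)]
    intro z hz
    refine h z (fun q hq => hz q (Ideal.mem_sup_left hq)) (hz p (Ideal.mem_sup_right ?_))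
    exact Ideal.mem_span_singleton_self p
  obtain ⟨N, hN⟩ := hg
  obtain ⟨a, ha, b, hb, hab⟩ := Submodule.mem_sup.1 hN
  obtain ⟨u, rfl⟩ := Ideal.mem_span_singleton'.1 hb
  refine ⟨N, u, le_vanishingIdeal_zeroLocus I ?_⟩
  rw [← hab, add_sub_cancel_right]
  exact ha

/-- A rational function on an irreducible variety that takes real values only is a real
constant. -/
theorem IsIrreducibleVariety.exists_eq_real_mul_of_im_eq_zero {X : Set (Fin n → ℂ)}
    (hX : IsIrreducibleVariety X) (f g : MvPolynomial (Fin n) ℂ)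
    (h : ∀ z ∈ X, (aeval z f * conj (aeval z g)).im = 0) (hg : ∃ z ∈ X, aeval z g ≠ 0) :
    ∃ c : ℝ, ∀ z ∈ X, aeval z f = c * aeval z g := by
  have hprime := hX.isPrime_vanishingIdeal
  let A := MvPolynomial (Fin n) ℂ ⧸ vanishingIdeal ℂ X
  let K := FractionRing A
  let π : MvPolynomial (Fin n) ℂ →ₐ[ℂ] K :=
    (IsScalarTower.toAlgHom ℂ A K).comp (Ideal.Quotient.mkₐ ℂ (vanishingIdeal ℂ X))
  have hπ : ∀ p, π p = 0 ↔ p ∈ vanishingIdeal ℂ X := fun p => by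
    change algebraMap A K (Ideal.Quotient.mk _ p) = 0 ↔ _
    rw [IsFractionRing.to_map_eq_zero_iff, Ideal.Quotient.eq_zero_iff_mem]
  obtain ⟨z₀, hz₀, hgz₀⟩ := hg
  have hg0 : π g ≠ 0 := fun h0 => hgz₀ ((hπ g).1 h0 z₀ hz₀)
  by_cases hx : Transcendental ℂ (π f / π g)
  · exfalso
    let φ : MvPolynomial (Option (Fin n)) ℂ →ₐ[ℂ] K :=
      aeval fun o => o.elim (π g)⁻¹ fun i => π (MvPolynomial.X i)
    have hφX : ∀ p, φ (rename some p) = π p := fun p => by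
      have : φ.comp (rename some) = π := by ext i; simp [φ]
      exact DFunLike.congr_fun this p
    have hφg : φ (MvPolynomial.X none) = (π g)⁻¹ := by simp [φ]
    obtain ⟨c, hc, hcφ⟩ := exists_inv_sub_notMem_range φ hx not_countable_im_ne_zero
    -- where `g` does not vanish, `f / g` is real and hence different from `c`
    have hzero : ∀ z ∈ X, aeval z (f - C c * g) = 0 → aeval z g = 0 := by
      intro z hz hfz
      have hfz' : aeval z f = c * aeval z g := by
        simpa [sub_eq_zero] using hfz
      have him := h z hz
      rw [hfz', mul_assoc, Complex.mul_conj, Complex.im_mul_ofReal] at him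
      exact Complex.normSq_eq_zero.1 ((mul_eq_zero.1 him).resolve_left hc)
    obtain ⟨N, u, hNu⟩ := hX.isVariety.exists_pow_sub_mul_mem hzero
    rw [← hπ, map_sub, map_mul, map_pow, map_sub, map_mul, sub_eq_zero] at hNu
    have hCc : π (C c) = algebraMap ℂ K c := π.commutes c
    rw [hCc] at hNu
    have hne : π f - algebraMap ℂ K c * π g ≠ 0 := fun h0 => by
      rw [h0, mul_zero] at hNu
      exact hg0 (eq_zero_of_pow_eq_zero hNu)
    -- `(h - c)⁻¹ = g / (f - c g) = g * u / g ^ N`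
    refine hcφ ⟨rename some (g * u) * MvPolynomial.X none ^ N, ?_⟩
    change φ _ = _
    rw [map_mul, map_pow, hφX, hφg, map_mul]
    have hsub : π f / π g - algebraMap ℂ K c = (π f - algebraMap ℂ K c * π g) / π g := by
      rw [sub_div, mul_div_cancel_right₀ _ hg0]
    rw [hsub, inv_div, inv_pow, eq_div_iff hne, mul_right_comm, mul_assoc (π g), ← hNu,
      mul_inv_cancel_right₀ (pow_ne_zero N hg0)]
  · rw [Transcendental, not_not] at hx
    obtain ⟨c, hc⟩ : ∃ c, algebraMap ℂ K c = π f / π g :=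
      minpoly.mem_range_of_degree_eq_one ℂ _
        (IsAlgClosed.degree_eq_one_of_irreducible ℂ (minpoly.irreducible hx.isIntegral))
    have hfg : f - C c * g ∈ vanishingIdeal ℂ X := by
      have hCc : π (C c) = algebraMap ℂ K c := π.commutes c
      rw [← hπ, map_sub, map_mul, hCc, hc, div_mul_cancel₀ _ hg0, sub_self]
    have hval : ∀ z ∈ X, aeval z f = c * aeval z g := fun z hz => by
      simpa [sub_eq_zero] using hfg z hz
    have him := h z₀ hz₀
    rw [hval z₀ hz₀, mul_assoc, Complex.mul_conj, Complex.im_mul_ofReal] at him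
    have hcim : c.im = 0 := (mul_eq_zero.1 him).resolve_right (mt Complex.normSq_eq_zero.1 hgz₀)
    refine ⟨c.re, fun z hz => ?_⟩
    have hcre : (c.re : ℂ) = c := Complex.ext rfl hcim.symm
    rw [hval z hz, hcre]

/-! ### Choosing samples one at a time -/

/-- Two complex numbers span `ℂ` over `ℝ` unless they are real multiples of each other. -/
theorem exists_real_combination {a b : ℂ} (h : (a * conj b).im ≠ 0) (w : ℂ) :
    ∃ s t : ℝ, s * a + t * b = w := by
  have hd : a.im * b.re - a.re * b.im ≠ 0 := by
    intro h0
    apply h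
    simp only [Complex.mul_im, Complex.conj_re, Complex.conj_im]
    linarith
  refine ⟨(w.im * b.re - w.re * b.im) / (a.im * b.re - a.re * b.im),
    (a.im * w.re - a.re * w.im) / (a.im * b.re - a.re * b.im), ?_⟩
  apply Complex.ext
  · simp only [Complex.add_re, Complex.re_ofReal_mul]
    rw [div_mul_eq_mul_div, div_mul_eq_mul_div, ← add_div, div_eq_iff hd]
    ring
  · simp only [Complex.add_im, Complex.im_ofReal_mul]
    rw [div_mul_eq_mul_div, div_mul_eq_mul_div, ← add_div, div_eq_iff hd]
    ring

/-- If proportionality over the reals of two elements of `M` can be tested pointwise, then samples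
can be chosen so that each lowers the dimension of the space of functions that vanish at all the
samples so far by `2`, or makes that space zero. -/
theorem exists_sample_of_finrank_le {X : Type*} [Nonempty X] {S : ℕ} :
    ∀ (M : Submodule ℝ (X → ℂ)) [FiniteDimensional ℝ M],
      (∀ f ∈ M, ∀ g ∈ M, g ≠ 0 → (∀ z, (f z * conj (g z)).im = 0) → ∃ c : ℝ, f = c • g) →
      finrank ℝ M ≤ 2 * S → ∃ z : Fin S → X, ∀ f ∈ M, (∀ s, f (z s) = 0) → f = 0 := by
  induction S with
  | zero =>
    intro M _ _ hdim
    have hM : M = ⊥ := Submodule.finrank_eq_zero.1 (by omega)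
    exact ⟨Fin.elim0, fun f hf _ => by simpa [hM] using hf⟩
  | succ S ih =>
    intro M _ hprop hdim
    by_cases hreal : ∀ f ∈ M, ∀ g ∈ M, ∀ z, (f z * conj (g z)).im = 0
    · by_cases hM : ∃ g ∈ M, g ≠ 0
      · obtain ⟨g, hgM, hg⟩ := hM
        obtain ⟨z, hz⟩ := Function.ne_iff.1 hg
        refine ⟨fun _ => z, fun f hf hfz => ?_⟩
        obtain ⟨c, rfl⟩ := hprop f hf g hgM hg (hreal f hf g hgM)
        have hc : c = 0 := by
          have := hfz 0
          rw [Pi.smul_apply, smul_eq_zero] at this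
          exact this.resolve_right hz
        rw [hc, zero_smul]
      · push Not at hM
        exact ⟨fun _ => Classical.arbitrary X, fun f hf _ => hM f hf⟩
    · push Not at hreal
      obtain ⟨f, hf, g, hg, z, hz⟩ := hreal
      let e : M →ₗ[ℝ] ℂ := (LinearMap.proj z).comp M.subtype
      have he : LinearMap.range e = ⊤ := by
        rw [LinearMap.range_eq_top]
        intro w
        obtain ⟨s, t, hst⟩ := exists_real_combination hz w
        exact ⟨s • ⟨f, hf⟩ + t • ⟨g, hg⟩, by simpa [e] using hst⟩
      have hrank := e.finrank_range_add_finrank_ker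
      rw [he, finrank_top, Complex.finrank_real_complex] at hrank
      let M' := (LinearMap.ker e).map M.subtype
      have hM' : ∀ f, f ∈ M' ↔ f ∈ M ∧ f z = 0 := fun f => by
        simp [M', e, and_comm]
      have hdim' : finrank ℝ M' = finrank ℝ (LinearMap.ker e) :=
        LinearEquiv.finrank_eq (Submodule.equivMapOfInjective _ M.subtype_injective _).symm
      obtain ⟨y, hy⟩ := ih M' (fun f hf g hg => hprop f ((hM' f).1 hf).1 g ((hM' g).1 hg).1)
        (by omega)
      refine ⟨Fin.cons z y, fun f hf hfz => hy f ((hM' f).2 ⟨hf, ?_⟩) fun s => ?_⟩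
      · simpa using hfz 0
      · simpa using hfz s.succ

/-! ### The Gram matrix as a polynomial in the samples and their conjugates -/

noncomputable section

namespace ConjPolynomial

/-- The real polynomial `p` at the `s`-th sample. -/
def atSample {S : ℕ} (p : MvPolynomial (Fin n) ℝ) (s : Fin S) : ConjPolynomial n S :=
  rename (fun k => Sum.inl (s, k)) (map (algebraMap ℝ ℂ) p)

/-- The real polynomial `p` at the complex conjugate of the `s`-th sample. -/
def atConjSample {S : ℕ} (p : MvPolynomial (Fin n) ℝ) (s : Fin S) : ConjPolynomial n S :=
  rename (fun k => Sum.inr (s, k)) (map (algebraMap ℝ ℂ) p)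

/-- Twice the real part of the Gram matrix of the vectors `(p j (z s))_s`, with each conjugate
`conj (p j (z s))` written as `p j (conj (z s))`. -/
def gram {S d : ℕ} (p : Fin d → MvPolynomial (Fin n) ℝ) :
    Matrix (Fin d) (Fin d) (ConjPolynomial n S) :=
  .of fun j k => ∑ s, (atConjSample (p j) s * atSample (p k) s
    + atSample (p j) s * atConjSample (p k) s)

end ConjPolynomial

end

theorem aeval_conj_real (z : Fin n → ℂ) (p : MvPolynomial (Fin n) ℝ) :
    aeval (fun k => conj (z k)) p = conj (aeval z p) :=
  (congrArg (fun φ : MvPolynomial (Fin n) ℝ →ₐ[ℝ] ℂ => φ p)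
    (show aeval (fun k => conj (z k)) = Complex.conjAe.toAlgHom.comp (aeval z) by ext; simp))

theorem conjEval_atSample {S : ℕ} (z : Fin S → Fin n → ℂ) (p : MvPolynomial (Fin n) ℝ)
    (s : Fin S) : conjEval z (ConjPolynomial.atSample p s) = aeval (z s) p := by
  rw [conjEval, ConjPolynomial.atSample, eval_rename, eval_map, aeval_def]
  rfl

theorem conjEval_atConjSample {S : ℕ} (z : Fin S → Fin n → ℂ) (p : MvPolynomial (Fin n) ℝ)
    (s : Fin S) : conjEval z (ConjPolynomial.atConjSample p s) = conj (aeval (z s) p) := by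
  rw [← aeval_conj_real, conjEval, ConjPolynomial.atConjSample, eval_rename, eval_map, aeval_def]
  rfl

/-- Twice the real Gram matrix of a family of vectors of `ℂ^S`, regarded as a real vector space. -/
def realGram {S d : ℕ} (v : Fin d → Fin S → ℂ) : Matrix (Fin d) (Fin d) ℝ :=
  .of fun j k => ∑ s, 2 * (conj (v j s) * v k s).re

theorem conjEval_det_gram {S d : ℕ} (z : Fin S → Fin n → ℂ)
    (p : Fin d → MvPolynomial (Fin n) ℝ) :
    conjEval z (ConjPolynomial.gram p).det
      = ((realGram fun j s => aeval (z s) (p j)).det : ℝ) := by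
  have hG : (eval (Sum.elim (fun q => z q.1 q.2) fun q => conj (z q.1 q.2))).mapMatrix
      (ConjPolynomial.gram p)
      = Complex.ofRealHom.mapMatrix (realGram fun j s => aeval (z s) (p j)) := by
    ext j k
    simp only [RingHom.mapMatrix_apply, Matrix.map_apply, ConjPolynomial.gram, realGram,
      Matrix.of_apply, map_sum, map_add, map_mul]
    refine Finset.sum_congr rfl fun s _ => ?_
    have h1 := conjEval_atSample z (p j) s
    have h2 := conjEval_atSample z (p k) s
    have h3 := conjEval_atConjSample z (p j) s
    have h4 := conjEval_atConjSample z (p k) s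
    unfold conjEval at h1 h2 h3 h4
    rw [h1, h2, h3, h4]
    generalize aeval (z s) (p j) = a
    generalize aeval (z s) (p k) = b
    apply Complex.ext
    · simp
      ring
    · simp
      ring
  rw [conjEval, RingHom.map_det, hG, ← RingHom.map_det]
  rfl

theorem realGram_mulVec {S d : ℕ} (v : Fin d → Fin S → ℂ) (x : Fin d → ℝ) (j : Fin d) :
    (realGram v).mulVec x j = ∑ s, 2 * (conj (v j s) * ∑ k, x k * v k s).re := by
  simp only [Matrix.mulVec, dotProduct, realGram, Matrix.of_apply, Finset.sum_mul, Finset.mul_sum,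
    Complex.re_sum]
  rw [Finset.sum_comm]
  refine Finset.sum_congr rfl fun s _ => Finset.sum_congr rfl fun k _ => ?_
  rw [mul_left_comm, Complex.re_ofReal_mul]
  ring

theorem dotProduct_realGram_mulVec {S d : ℕ} (v : Fin d → Fin S → ℂ) (x : Fin d → ℝ) :
    x ⬝ᵥ (realGram v).mulVec x = ∑ s, 2 * Complex.normSq (∑ j, x j * v j s) := by
  simp only [dotProduct, realGram_mulVec, Finset.mul_sum (s := (Finset.univ : Finset (Fin S)))]
  rw [Finset.sum_comm]
  refine Finset.sum_congr rfl fun s _ => ?_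
  have hF : Complex.normSq (∑ j, x j * v j s)
      = (conj (∑ j, x j * v j s) * ∑ k, x k * v k s).re := by
    rw [mul_comm, Complex.mul_conj, Complex.ofReal_re]
  rw [hF, map_sum, Finset.sum_mul, Complex.re_sum, Finset.mul_sum]
  refine Finset.sum_congr rfl fun j _ => ?_
  rw [map_mul, Complex.conj_ofReal, mul_assoc, Complex.re_ofReal_mul]
  ring

theorem det_realGram_ne_zero_iff {S d : ℕ} (v : Fin d → Fin S → ℂ) :
    (realGram v).det ≠ 0 ↔ ∀ x : Fin d → ℝ, (∀ s, ∑ j, x j * v j s = 0) → x = 0 := by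
  rw [Ne, ← Matrix.exists_mulVec_eq_zero_iff, ← not_iff_not, not_not]
  push Not
  refine exists_congr fun x => ?_
  rw [and_comm]
  refine and_congr_left fun _ => ⟨fun hx s => ?_, fun hx => ?_⟩
  · have h0 := dotProduct_realGram_mulVec v x
    rw [hx, dotProduct_zero, eq_comm, Finset.sum_eq_zero_iff_of_nonneg
      fun s _ => mul_nonneg zero_le_two (Complex.normSq_nonneg _)] at h0
    simpa using h0 s (Finset.mem_univ s)
  · ext j
    simp [realGram_mulVec, hx]

/-! ### Generic samples on one component -/

/-- On an irreducible variety `X`, generic tuples of at least `dim M / 2` samples detect the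
elements of a real space `M` of functions given by real polynomials. -/
theorem IsIrreducibleVariety.exists_conjPolynomial {X : Set (Fin n → ℂ)}
    (hX : IsIrreducibleVariety X) (M : Submodule ℝ (X → ℂ)) [FiniteDimensional ℝ M]
    (hM : ∀ f ∈ M, ∃ p : MvPolynomial (Fin n) ℝ, ∀ z : X, f z = aeval (z : Fin n → ℂ) p)
    {S : ℕ} (hS : finrank ℝ M ≤ 2 * S) :
    ∃ q : ConjPolynomial n S,
      (∃ Z : Fin S → X, conjEval (fun s => (Z s : Fin n → ℂ)) q ≠ 0) ∧
      ∀ Z : Fin S → X, conjEval (fun s => (Z s : Fin n → ℂ)) q ≠ 0 →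
        ∀ f ∈ M, (∀ s, f (Z s) = 0) → f = 0 := by
  have : Nonempty X := hX.nonempty.to_subtype
  let b := finBasis ℝ M
  choose p hp using fun j => hM (b j) (b j).2
  have hb : ∀ (x : Fin (finrank ℝ M) → ℝ) (z : X),
      ∑ j, x j * aeval (z : Fin n → ℂ) (p j) = ((∑ j, x j • b j : M) : X → ℂ) z := by
    intro x z
    simp [← hp, Finset.sum_apply]
  have hdet : ∀ Z : Fin S → X,
      conjEval (fun s => (Z s : Fin n → ℂ)) (ConjPolynomial.gram p).det ≠ 0 ↔
        ∀ x : Fin (finrank ℝ M) → ℝ,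
          (∀ s, ((∑ j, x j • b j : M) : X → ℂ) (Z s) = 0) → x = 0 := by
    intro Z
    rw [conjEval_det_gram, Complex.ofReal_ne_zero, det_realGram_ne_zero_iff]
    simp only [hb]
  refine ⟨(ConjPolynomial.gram p).det, ?_, fun Z hZ f hf hfZ => ?_⟩
  · obtain ⟨Z, hZ⟩ := exists_sample_of_finrank_le M (fun f hf g hg hg0 him => by
      obtain ⟨pf, hpf⟩ := hM f hf
      obtain ⟨pg, hpg⟩ := hM g hg
      obtain ⟨z, hz⟩ := Function.ne_iff.1 hg0
      have hmap : ∀ (p : MvPolynomial (Fin n) ℝ) (z : Fin n → ℂ),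
          aeval z (map (algebraMap ℝ ℂ) p) = aeval z p := fun p z => aeval_map_algebraMap ℂ z p
      obtain ⟨c, hc⟩ := hX.exists_eq_real_mul_of_im_eq_zero (map (algebraMap ℝ ℂ) pf)
        (map (algebraMap ℝ ℂ) pg)
        (fun z hz => by simpa only [hmap, hpf, hpg] using him ⟨z, hz⟩)
        ⟨z, z.2, by rw [hmap, ← hpg]; exact hz⟩
      refine ⟨c, funext fun z => ?_⟩
      have := hc z z.2
      rw [hmap, hmap, ← hpf, ← hpg] at this
      simpa using this) hS
    refine ⟨Z, (hdet Z).2 fun x hx => ?_⟩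
    have h0 : ∑ j, x j • b j = 0 := Subtype.ext (hZ _ (Subtype.prop _) hx)
    exact funext (Fintype.linearIndependent_iff.1 b.linearIndependent x h0)
  · have hrepr := b.sum_repr ⟨f, hf⟩
    have h0 := (hdet Z).1 hZ (b.repr ⟨f, hf⟩) (by rw [hrepr]; exact hfZ)
    rw [h0] at hrepr
    simpa using (congrArg Subtype.val hrepr).symm

/-- A real polynomial that vanishes on `W` vanishes on the complex conjugate of `W`. -/
theorem eq_zero_of_evalAt_eq_zero {W : Set (Fin n → ℂ)} (f : RealCoordinateRing (W ∪ conjSet W))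
    (hf : ∀ z (hz : z ∈ W), evalAt ⟨z, Or.inl hz⟩ f = 0) : f = 0 := by
  obtain ⟨p, rfl⟩ := Ideal.Quotient.mk_surjective f
  rw [Ideal.Quotient.eq_zero_iff_mem]
  rintro z (hz | ⟨w, hw, rfl⟩)
  · exact hf z hz
  · have hpw : aeval w p = 0 := hf w hw
    rw [aeval_conj_real, hpw, map_zero]

end SampledVariety

open SampledVariety
theorem mainTheorem3 {n r : ℕ} (W : Set (Fin n → ℂ)) (hW : IsVariety W)
    (Wi : Fin r → Set (Fin n → ℂ)) (hWi : IsIrreducibleDecomposition W Wi)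
    (L : Submodule ℝ (RealCoordinateRing (W ∪ conjSet W))) (hL : FiniteDimensional ℝ L)
    (S : Fin r → ℕ) (hS : ∀ i, (Module.finrank ℝ L : ℝ) / 2 ≤ (S i : ℝ)) :
    CGenerically Wi S (fun Z =>
      IsPoised L {z | ∃ (i : Fin r) (s : Fin (S i)), (z : Fin n → ℂ) = Z i s}) := by
  have hsub : ∀ i, Wi i ⊆ W := fun i => hWi.eq_iUnion ▸ Set.subset_iUnion Wi i
  let ρ : ∀ i, RealCoordinateRing (W ∪ conjSet W) →ₗ[ℝ] (Wi i → ℂ) := fun i =>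
    LinearMap.pi fun z => (evalAt ⟨z, Or.inl (hsub i z.2)⟩).toLinearMap
  have hcomp : ∀ i, ∃ q : ConjPolynomial n (S i),
      (∃ Z : Fin (S i) → Wi i, conjEval (fun s => (Z s : Fin n → ℂ)) q ≠ 0) ∧
      ∀ Z : Fin (S i) → Wi i, conjEval (fun s => (Z s : Fin n → ℂ)) q ≠ 0 →
        ∀ f ∈ L.map (ρ i), (∀ s, f (Z s) = 0) → f = 0 := by
    intro i
    refine (hWi.irreducible i).exists_conjPolynomial (L.map (ρ i)) ?_ ?_
    · rintro _ ⟨f, -, rfl⟩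
      obtain ⟨p, rfl⟩ := Ideal.Quotient.mk_surjective f
      exact ⟨p, fun z => rfl⟩
    · have h1 : Module.finrank ℝ (L.map (ρ i)) ≤ Module.finrank ℝ L :=
        Submodule.finrank_map_le (ρ i) L
      have h2 : (Module.finrank ℝ L : ℝ) ≤ 2 * S i := by linarith [hS i]
      exact h1.trans (by exact_mod_cast h2)
  choose q hq0 hq using hcomp
  refine ⟨q, hq0, fun Z hZ f hfL hfZ => eq_zero_of_evalAt_eq_zero f fun z hz => ?_⟩
  obtain ⟨i, hzi⟩ := Set.mem_iUnion.1 (hWi.eq_iUnion ▸ hz : z ∈ ⋃ i, Wi i)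
  have hρ : ρ i f = 0 := hq i (Z i) (hZ i) _ (Submodule.mem_map_of_mem hfL) fun s =>
    hfZ _ ⟨i, s, rfl⟩
  exact congrFun hρ ⟨z, hzi⟩
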